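/- Let $n\ge 2$, let $A=\operatorname{diag}(\lambda_1,\dots,\lambda_n)$ be a real $n\times n$ diagonal matrix with $|\det A|>1$, $$|\lambda_1|\ge|\lambda_2|\ge\cdots\ge|\lambda_{n-1}|>1>|\lambda_n|,\qquad |\lambda_{n-1}\lambda_n|\ge 1,$$ and let $\Gamma\subset\mathbb{R}^n$ be a full-rank lattice. An $(A,\Gamma)$ wavelet set is a Lebesgue measurable set $W\subset\mathbb{R}^n$ such that, for Lebesgue-almost every $x\in\mathbb{R}^n$, $$\sum_{j\in\mathbb{Z}}\mathbf 1_W(A^jx)=1\qquad\text{and}\qquad \sum_{\gamma\in\Gamma}\mathbf 1_W(x+\gamma)=1 .$$ Then there exists an $(A,\Gamma)$ wavelet set if and only if $\Gamma\cap\operatorname{span}(e_n)=\{0\}$, where $e_n$ is the last standard unit basis vector of $\mathbb{R}^n$. -/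

import Mathlib

open MeasureTheory
open scoped ENNReal

/-- `U` packs by `A` dilations: `∑_{j ∈ ℤ} 1_U(A^j x) ≤ 1` for Lebesgue-a.e. `x ∈ ℝⁿ`. The sum is
taken in `[0, ∞]`, so it always has its true value. (`A ^ j` is the integer power of an invertible
matrix.) -/
def PacksByDilations {n : ℕ} (A : Matrix (Fin n) (Fin n) ℝ) (U : Set (Fin n → ℝ)) : Prop :=
  ∀ᵐ x : Fin n → ℝ, ∑' j : ℤ, U.indicator (fun _ => (1 : ℝ≥0∞)) ((A ^ j).mulVec x) ≤ 1

/-- `U` covers by `A` dilations: `∑_{j ∈ ℤ} 1_U(A^j x) ≥ 1` for Lebesgue-a.e. `x ∈ ℝⁿ`. -/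
def CoversByDilations {n : ℕ} (A : Matrix (Fin n) (Fin n) ℝ) (U : Set (Fin n → ℝ)) : Prop :=
  ∀ᵐ x : Fin n → ℝ, 1 ≤ ∑' j : ℤ, U.indicator (fun _ => (1 : ℝ≥0∞)) ((A ^ j).mulVec x)

/-- `V` packs by `Γ` translations: `∑_{γ ∈ Γ} 1_V(x + γ) ≤ 1` for Lebesgue-a.e. `x ∈ ℝⁿ`. -/
def PacksByTranslations {n : ℕ} (Γ : Submodule ℤ (Fin n → ℝ)) (V : Set (Fin n → ℝ)) : Prop :=
  ∀ᵐ x : Fin n → ℝ, ∑' γ : Γ, V.indicator (fun _ => (1 : ℝ≥0∞)) (x + (γ : Fin n → ℝ)) ≤ 1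

/-- `V` covers by `Γ` translations: `∑_{γ ∈ Γ} 1_V(x + γ) ≥ 1` for Lebesgue-a.e. `x ∈ ℝⁿ`. -/
def CoversByTranslations {n : ℕ} (Γ : Submodule ℤ (Fin n → ℝ)) (V : Set (Fin n → ℝ)) : Prop :=
  ∀ᵐ x : Fin n → ℝ, 1 ≤ ∑' γ : Γ, V.indicator (fun _ => (1 : ℝ≥0∞)) (x + (γ : Fin n → ℝ))

/-- `W` is an `(A, Γ)` wavelet set: `W` is Lebesgue measurable, and it tiles (packs and covers)
`ℝⁿ` both by `A` dilations and by `Γ` translations. -/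
structure IsWaveletSet {n : ℕ} (A : Matrix (Fin n) (Fin n) ℝ) (Γ : Submodule ℤ (Fin n → ℝ))
    (W : Set (Fin n → ℝ)) : Prop where
  measurable : NullMeasurableSet W volume
  packs_dil : PacksByDilations A W
  covers_dil : CoversByDilations A W
  packs_trans : PacksByTranslations Γ W
  covers_trans : CoversByTranslations Γ W

/-! Sufficiency is a Cantor–Bernstein argument (`exists_common_tile`): it is enough to find `U` that
tiles by translations and packs by dilations, and `V` that tiles by dilations and packs by
translations. `U` is a lattice cell pushed far out along an expanding axis.

For `V`, the key is `exists_frequently_card_le`: for infinitely many `m`, the number of `γ ∈ Γ` with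
`‖A ^ m γ‖ ≤ R` is bounded independently of `m`. If `v`, `w` are two such vectors, their 2×2 minors
are bounded because `|λ_i λ_j| ≥ 1` for `i ≠ j`; in lattice coordinates these minors are integers,
so only boundedly many classes of `w` modulo the line of `v` occur. Triviality of `Γ ∩ span(e_n)`
forces `v` to expand eventually, and at its last short time the line of `v` contributes boundedly
many vectors. So a fixed fraction of any bounded set can be packed at infinitely many scales. A
greedy choice with rapidly growing `m` and Borel–Cantelli gives `V`.

Necessity is a volume count. A nonzero lattice vector on the contracting axis makes the sets `A ^ m
W`, `m ≥ 0`, fill only `O(N ^ (n - 1))` of a cube of side `N`, while the sets `A ^ (-m) W` have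
finite total measure. -/

/-- `T` is an action of the additive group `G` on `Ω`. -/
structure IsFlow {G Ω : Type*} [AddCommGroup G] (T : G → Ω → Ω) : Prop where
  zero : ∀ x, T 0 x = x
  add : ∀ g h x, T (g + h) x = T g (T h x)

/-- The translates of `X` under `T` are pairwise disjoint. -/
def PacksUnder {G Ω : Type*} [AddCommGroup G] (T : G → Ω → Ω) (X : Set Ω) : Prop :=
  ∀ x ∈ X, ∀ g, T g x ∈ X → g = 0

/-! ### Orbits, packings and a measurable Cantor–Bernstein theorem. -/

section Flow

variable {G H Ω : Type*} [AddCommGroup G] [AddCommGroup H]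

theorem IsFlow.neg_apply {T : G → Ω → Ω} (hT : IsFlow T) (g : G) (x : Ω) : T (-g) (T g x) = x := by
  rw [← hT.add, neg_add_cancel, hT.zero]

theorem IsFlow.apply_neg {T : G → Ω → Ω} (hT : IsFlow T) (g : G) (x : Ω) : T g (T (-g) x) = x := by
  rw [← hT.add, add_neg_cancel, hT.zero]

theorem PacksUnder.mono {T : G → Ω → Ω} {X Y : Set Ω} (hY : PacksUnder T Y) (h : X ⊆ Y) :
    PacksUnder T X := fun x hx g hg => hY x (h hx) g (h hg)

theorem PacksUnder.eq_of_mem {T : G → Ω → Ω} (hT : IsFlow T) {X : Set Ω} (hX : PacksUnder T X)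
    {x : Ω} {g h : G} (hg : T g x ∈ X) (hh : T h x ∈ X) : g = h := by
  refine (sub_eq_zero.1 (hX _ hg (h - g) ?_)).symm
  rwa [← hT.add, sub_add_cancel]

theorem PacksUnder.tsum_indicator_le {T : G → Ω → Ω} (hT : IsFlow T) {X : Set Ω}
    (hX : PacksUnder T X) (x : Ω) :
    ∑' g, X.indicator (fun _ => (1 : ℝ≥0∞)) (T g x) ≤ 1 := by
  by_cases h : ∃ g, T g x ∈ X
  · obtain ⟨g, hg⟩ := h
    rw [tsum_eq_single g]
    · exact Set.indicator_le_self' (fun _ _ => zero_le) _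
    · intro g' hg'
      refine Set.indicator_of_notMem (fun h' => hg' (hX.eq_of_mem hT h' hg)) _
  · push Not at h
    simp [Set.indicator_of_notMem (h _)]

theorem one_le_tsum_indicator_iff {G Ω : Type*} {T : G → Ω → Ω} {X : Set Ω} {x : Ω} :
    1 ≤ ∑' g, X.indicator (fun _ => (1 : ℝ≥0∞)) (T g x) ↔ ∃ g, T g x ∈ X := by
  constructor
  · intro h
    by_contra! h'
    simp [Set.indicator_of_notMem (h' _)] at h
  · rintro ⟨g, hg⟩
    calc (1 : ℝ≥0∞) = X.indicator (fun _ => (1 : ℝ≥0∞)) (T g x) := by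
          rw [Set.indicator_of_mem hg]
      _ ≤ _ := ENNReal.le_tsum g

variable [MeasurableSpace Ω]

/-- A measurable set contained in the saturation of a measurable packing set contains a measurable
transversal of its own orbits. -/
theorem exists_packing_subset [Countable G] {T : G → Ω → Ω} (hT : IsFlow T)
    (hTm : ∀ g, Measurable (T g)) {F X : Set Ω} (hF : MeasurableSet F) (hX : MeasurableSet X)
    (hFp : PacksUnder T F) (hXF : ∀ x ∈ X, ∃ g, T g x ∈ F) :
    ∃ P ⊆ X, MeasurableSet P ∧ PacksUnder T P ∧ ∀ x ∈ X, ∃ g, T g x ∈ P := by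
  obtain ⟨e, he⟩ := exists_injective_nat G
  -- An orbit meets `F` at most once, so its point in `F` serves as a base point; `K g` collects the
  -- base points for which `g` is the first element, in the enumeration `e`, leading into `X`.
  let K : G → Set Ω := fun g => (F ∩ T g ⁻¹' X) ∩ ⋂ (g' : G) (_ : e g' < e g), (T g' ⁻¹' X)ᶜ
  have hK : ∀ g, MeasurableSet (K g) := fun g =>
    (hF.inter (hTm g hX)).inter
      (MeasurableSet.iInter fun g' => MeasurableSet.iInter fun _ => (hTm g' hX).compl)
  have hmem : ∀ g x, x ∈ K g ↔ x ∈ F ∧ T g x ∈ X ∧ ∀ g', e g' < e g → T g' x ∉ X := by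
    intro g x
    simp [K, and_assoc]
  refine ⟨⋃ g, T (-g) ⁻¹' K g, ?_, MeasurableSet.iUnion fun g => hTm _ (hK g), ?_, ?_⟩
  · intro x hx
    obtain ⟨g, hg⟩ := Set.mem_iUnion.1 hx
    have := ((hmem _ _).1 hg).2.1
    rwa [hT.apply_neg] at this
  · intro x hx h hh
    obtain ⟨g, hg⟩ := Set.mem_iUnion.1 hx
    obtain ⟨g', hg'⟩ := Set.mem_iUnion.1 hh
    rw [Set.mem_preimage, ← hT.add] at hg'
    rw [Set.mem_preimage] at hg
    have hkey : -g = -g' + h :=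
      hFp.eq_of_mem hT ((hmem _ _).1 hg).1 ((hmem _ _).1 hg').1
    rw [← hkey] at hg'
    rw [hmem] at hg hg'
    have : g = g' := by
      rcases lt_trichotomy (e g) (e g') with h1 | h1 | h1
      · exact absurd hg.2.1 (hg'.2.2 _ h1)
      · exact he h1
      · exact absurd hg'.2.1 (hg.2.2 _ h1)
    subst this
    simpa using hkey
  · intro x hx
    obtain ⟨k, hk⟩ := hXF x hx
    have hne : ∃ m, ∃ g, e g = m ∧ T g (T k x) ∈ X := ⟨_, -k, rfl, by rwa [hT.neg_apply]⟩
    classical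
    obtain ⟨g, hg, hgX⟩ := Nat.find_spec hne
    refine ⟨g + k, Set.mem_iUnion.2 ⟨g, ?_⟩⟩
    rw [Set.mem_preimage, hT.add, hT.neg_apply, hmem]
    exact ⟨hk, hgX, fun g' hg' hc => Nat.find_min hne (hg ▸ hg') ⟨g', rfl, hc⟩⟩

/-- A measurable Cantor–Bernstein theorem for the orbits of two actions. -/
theorem exists_common_tile [Countable G] [Countable H] {μ : Measure Ω}
    {T : G → Ω → Ω} {S : H → Ω → Ω} (hT : IsFlow T) (hS : IsFlow S)
    (hTm : ∀ g, Measurable (T g)) (hSm : ∀ h, Measurable (S h)) {U V : Set Ω}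
    (hU : MeasurableSet U) (hV : MeasurableSet V)
    (hUT : PacksUnder T U) (hUS : PacksUnder S U) (hUc : ∀ᵐ x ∂μ, ∃ h, S h x ∈ U)
    (hVT : PacksUnder T V) (hVS : PacksUnder S V) (hVc : ∀ᵐ x ∂μ, ∃ g, T g x ∈ V) :
    ∃ W, MeasurableSet W ∧ PacksUnder T W ∧ PacksUnder S W ∧
      (∀ᵐ x ∂μ, ∃ g, T g x ∈ W) ∧ ∀ᵐ x ∂μ, ∃ h, S h x ∈ W := by
  -- View a point as an edge joining its `T`-orbit to its `S`-orbit, so that `U` and `V` are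
  -- matchings. A `T`-orbit missed by `U` must use its `V`-edge; this displaces the `U`-edge at the
  -- other end, whose `T`-orbit must then use `V` as well, and so on. `Y` is the union of all
  -- `V`-edges forced in this way.
  let Z : ℕ → Set Ω := fun k => Nat.rec (V ∩ ⋂ g, (T g ⁻¹' U)ᶜ)
    (fun _ Y => V ∩ ⋃ g, T g ⁻¹' (U ∩ ⋃ h, S h ⁻¹' Y)) k
  have hZ0 : Z 0 = V ∩ ⋂ g, (T g ⁻¹' U)ᶜ := rfl
  have hZs : ∀ k, Z (k + 1) = V ∩ ⋃ g, T g ⁻¹' (U ∩ ⋃ h, S h ⁻¹' Z k) := fun _ => rfl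
  have hZm : ∀ k, MeasurableSet (Z k) := by
    intro k
    induction k with
    | zero => exact hV.inter (MeasurableSet.iInter fun g => (hTm g hU).compl)
    | succ k ih =>
      exact hV.inter (MeasurableSet.iUnion fun g => hTm g
        (hU.inter (MeasurableSet.iUnion fun h => hSm h ih)))
  have hZV : ⋃ k, Z k ⊆ V := by
    refine Set.iUnion_subset fun k => ?_
    cases k <;> exact Set.inter_subset_left
  set Y := ⋃ k, Z k with hY
  have hYm : MeasurableSet Y := MeasurableSet.iUnion hZm
  have hmemY : ∀ x, x ∈ Y ↔ x ∈ V ∧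
      ((∀ g, T g x ∉ U) ∨ ∃ g, T g x ∈ U ∧ ∃ h, S h (T g x) ∈ Y) := by
    intro x
    constructor
    · intro hx
      refine ⟨hZV hx, ?_⟩
      obtain ⟨k, hk⟩ := Set.mem_iUnion.1 hx
      cases k with
      | zero =>
        left
        simpa using hk.2
      | succ k =>
        right
        rw [hZs] at hk
        obtain ⟨g, hg, hg'⟩ := Set.mem_iUnion.1 hk.2
        obtain ⟨h, hh⟩ := Set.mem_iUnion.1 hg'
        exact ⟨g, hg, h, Set.mem_iUnion.2 ⟨k, hh⟩⟩
    · rintro ⟨hxV, h | ⟨g, hg, h, hh⟩⟩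
      · exact Set.mem_iUnion.2 ⟨0, hxV, by simpa using h⟩
      · obtain ⟨k, hk⟩ := Set.mem_iUnion.1 hh
        exact Set.mem_iUnion.2 ⟨k + 1, hxV, Set.mem_iUnion.2 ⟨g, hg, Set.mem_iUnion.2 ⟨h, hk⟩⟩⟩
  have cross : ∀ x ∈ Y, ∀ g, T g x ∈ U → (∀ h, S h (T g x) ∉ Y) → False := by
    intro x hx g hg hn
    rcases ((hmemY x).1 hx).2 with h | ⟨g', hg', h, hh⟩
    · exact h g hg
    · exact hn h (hUT.eq_of_mem hT hg hg' ▸ hh)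
  -- Forced `V`-edges, together with the `U`-edges they do not displace.
  refine ⟨Y ∪ (U ∩ ⋂ h, (S h ⁻¹' Y)ᶜ), hYm.union (hU.inter
    (MeasurableSet.iInter fun h => (hSm h hYm).compl)), ?_, ?_, ?_, ?_⟩
  · rintro x (hx | hx) g (hg | hg)
    · exact hVT x (hZV hx) g (hZV hg)
    · exact (cross x hx g hg.1 (by simpa using hg.2)).elim
    · refine (cross _ hg (-g) ?_ ?_).elim
      · rw [hT.neg_apply]; exact hx.1
      · rw [hT.neg_apply]; simpa using hx.2
    · exact hUT x hx.1 g hg.1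
  · rintro x (hx | hx) g (hg | hg)
    · exact hVS x (hZV hx) g (hZV hg)
    · have h2 := Set.mem_iInter.1 hg.2 (-g)
      rw [Set.mem_compl_iff, Set.mem_preimage, hS.neg_apply] at h2
      exact absurd hx h2
    · exact absurd hg (Set.mem_iInter.1 hx.2 g)
    · exact hUS x hx.1 g hg.1
  · filter_upwards [hVc] with x ⟨g, hg⟩
    by_cases hY1 : T g x ∈ Y
    · exact ⟨g, Or.inl hY1⟩
    · have h1 : ¬((∀ g', T g' (T g x) ∉ U) ∨
          ∃ g', T g' (T g x) ∈ U ∧ ∃ h, S h (T g' (T g x)) ∈ Y) :=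
        fun h => hY1 ((hmemY _).2 ⟨hg, h⟩)
      push Not at h1
      obtain ⟨⟨g', hg'⟩, h2⟩ := h1
      refine ⟨g' + g, Or.inr ?_⟩
      rw [hT.add]
      exact ⟨hg', by simpa using h2 g' hg'⟩
  · filter_upwards [hUc] with x ⟨h, hh⟩
    by_cases h1 : ∃ h', S h' (S h x) ∈ Y
    · obtain ⟨h', h1⟩ := h1
      exact ⟨h' + h, Or.inl (by rwa [hS.add])⟩
    · exact ⟨h, Or.inr ⟨hh, by simpa using h1⟩⟩

/-- If the translates of `X` are almost everywhere disjoint and every point of `X` can be moved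
into `Y`, then `Y` is at least as large as `X`. -/
theorem measure_le_of_packs [Countable G] {μ : Measure Ω} {T : G → Ω → Ω} (hT : IsFlow T)
    (hTm : ∀ g, MeasurePreserving (T g) μ μ) {X Y : Set Ω} (hX : NullMeasurableSet X μ)
    (hY : MeasurableSet Y)
    (hp : ∀ᵐ x ∂μ, ∑' g, X.indicator (fun _ => (1 : ℝ≥0∞)) (T g x) ≤ 1)
    (hXY : ∀ x ∈ X, ∃ g, T g x ∈ Y) : μ X ≤ μ Y := by
  have hnm : ∀ g, NullMeasurableSet (T g ⁻¹' X) μ := fun g =>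
    hX.preimage (hTm g).quasiMeasurePreserving
  calc μ X ≤ μ (⋃ g, X ∩ T g ⁻¹' Y) := measure_mono fun x hx =>
        let ⟨g, hg⟩ := hXY x hx
        Set.mem_iUnion.2 ⟨g, hx, hg⟩
    _ ≤ ∑' g, μ (X ∩ T g ⁻¹' Y) := measure_iUnion_le _
    -- Mass transport: each piece of `X` is moved into `Y` by its own `g`, and packing bounds the
    -- multiplicity of the moved pieces by 1.
    _ = ∑' g, μ (T (-g) ⁻¹' X ∩ Y) := by
        congr 1
        ext g
        rw [← (hTm g).measure_preimage ((hnm (-g)).inter hY.nullMeasurableSet)]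
        congr 1
        ext x
        simp [hT.neg_apply]
    _ = ∑' g, μ (T g ⁻¹' X ∩ Y) := (Equiv.neg G).tsum_eq fun g => μ (T g ⁻¹' X ∩ Y)
    _ = ∑' g, ∫⁻ x in Y, (T g ⁻¹' X).indicator (fun _ => (1 : ℝ≥0∞)) x ∂μ := by
        congr 1
        ext g
        rw [lintegral_indicator₀ ((hnm g).mono_ac Measure.restrict_le_self.absolutelyContinuous)]
        simp [Measure.restrict_apply₀' hY.nullMeasurableSet]
    _ = ∫⁻ x in Y, ∑' g, X.indicator (fun _ => (1 : ℝ≥0∞)) (T g x) ∂μ := by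
        rw [lintegral_tsum]
        · rfl
        · intro g
          exact (aemeasurable_const.indicator₀
            ((hnm g).mono_ac Measure.restrict_le_self.absolutelyContinuous))
    _ ≤ ∫⁻ _ in Y, 1 ∂μ := lintegral_mono_ae (ae_restrict_of_ae hp)
    _ = μ Y := by simp

end Flow

/-! ### Choice of sequences by strong recursion. -/

/-- Recursion with access to the whole history. -/
noncomputable def historySeq {α : Type*} (a : α) (s : ℕ → (ℕ → α) → α) : ℕ → α
  | k => s k (fun l => if _h : l < k then historySeq a s l else a)

theorem exists_seq_of_history {α : Type*} [Nonempty α] (R : ℕ → (ℕ → α) → α → Prop)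
    (hR : ∀ k f g a, (∀ l < k, f l = g l) → R k f a → R k g a)
    (h : ∀ k f, (∀ l < k, R l f (f l)) → ∃ a, R k f a) : ∃ f : ℕ → α, ∀ k, R k f (f k) := by
  classical
  obtain ⟨a⟩ := ‹Nonempty α›
  have h' : ∀ k f, ∃ b, (∀ l < k, R l f (f l)) → R k f b := fun k f =>
    if hf : ∀ l < k, R l f (f l) then (h k f hf).imp fun _ hb _ => hb
    else ⟨a, fun hc => absurd hc hf⟩
  choose s hs using h'
  refine ⟨historySeq a s, fun k => ?_⟩
  induction k using Nat.strong_induction_on with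
  | _ k ih =>
    rw [historySeq]
    have key : ∀ l < k, historySeq a s l =
        (fun l => if _h : l < k then historySeq a s l else a) l := fun l hl => by simp [hl]
    refine hR k _ _ _ (fun l hl => (key l hl).symm) (hs _ _ fun l hl => ?_)
    have := ih l hl
    have e := key l hl
    beta_reduce at e ⊢
    rw [← e]
    exact hR l _ _ _ (fun l' hl' => key l' (hl'.trans hl)) this

/-! ### Powers of a diagonal matrix. -/

section Dilation

variable {ι : Type*}

/-- The action of `ℤ` by powers of the diagonal matrix with entries `lam`. -/
noncomputable def dil (lam : ι → ℝ) (j : ℤ) (x : ι → ℝ) : ι → ℝ := fun i => lam i ^ j * x i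

theorem diagonal_zpow_mulVec [Fintype ι] [DecidableEq ι] {lam : ι → ℝ} (h : ∀ i, lam i ≠ 0)
    (j : ℤ) (x : ι → ℝ) : (Matrix.diagonal lam ^ j).mulVec x = dil lam j x := by
  have key : Matrix.diagonal lam ^ j = Matrix.diagonal fun i => lam i ^ j := by
    cases j with
    | ofNat m =>
      simp only [Int.ofNat_eq_natCast, zpow_natCast, Matrix.diagonal_pow]
      rfl
    | negSucc m =>
      rw [zpow_negSucc, Matrix.diagonal_pow]
      apply Matrix.inv_eq_right_inv
      rw [Matrix.diagonal_mul_diagonal, ← Matrix.diagonal_one]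
      congr 1
      ext i
      rw [zpow_negSucc, Pi.pow_apply]
      exact mul_inv_cancel₀ (pow_ne_zero _ (h i))
  ext i
  rw [key, Matrix.mulVec_diagonal]
  rfl

theorem isFlow_dil {lam : ι → ℝ} (h : ∀ i, lam i ≠ 0) : IsFlow (dil lam) where
  zero x := by ext i; simp [dil]
  add j k x := by ext i; simp [dil, zpow_add₀ (h i), mul_assoc]

theorem dil_add (lam : ι → ℝ) (j : ℤ) (x y : ι → ℝ) :
    dil lam j (x + y) = dil lam j x + dil lam j y := by
  ext i; simp [dil, mul_add]

theorem dil_smul (lam : ι → ℝ) (j : ℤ) (c : ℝ) (x : ι → ℝ) :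
    dil lam j (c • x) = c • dil lam j x := by
  ext i; simp [dil]; ring

theorem measurable_dil (lam : ι → ℝ) (j : ℤ) : Measurable (dil lam j) := by
  unfold dil
  fun_prop

variable [Fintype ι]

theorem volume_preimage_dil {lam : ι → ℝ} (h : ∀ i, lam i ≠ 0) (j : ℤ) (s : Set (ι → ℝ)) :
    volume (dil lam j ⁻¹' s) = ENNReal.ofReal (|∏ i, lam i| ^ (-j)) * volume s := by
  classical
  have hd : LinearMap.det (Matrix.toLin' (Matrix.diagonal fun i => lam i ^ j)) =
      (∏ i, lam i) ^ j := by
    rw [LinearMap.det_toLin', Matrix.det_diagonal, Finset.prod_zpow]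
  have hf : dil lam j = Matrix.toLin' (Matrix.diagonal fun i => lam i ^ j) := by
    ext x i
    simp [dil, Matrix.mulVec_diagonal]
  rw [hf, Measure.addHaar_preimage_linearMap, hd, ← zpow_neg, abs_zpow]
  rw [hd]
  exact zpow_ne_zero _ (Finset.prod_ne_zero_iff.2 fun i _ => h i)

theorem quasiMeasurePreserving_dil {lam : ι → ℝ} (h : ∀ i, lam i ≠ 0) (j : ℤ) :
    Measure.QuasiMeasurePreserving (dil lam j) := by
  refine ⟨measurable_dil lam j, Measure.AbsolutelyContinuous.mk fun s hs h0 => ?_⟩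
  rw [Measure.map_apply (measurable_dil lam j) hs, volume_preimage_dil h, h0, mul_zero]

end Dilation

/-! ### Lattice translations. -/

section Translation

variable {E : Type*} [AddCommGroup E] [Module ℤ E]

/-- The action of a subgroup by translations. -/
def shift (Γ : Submodule ℤ E) (γ : Γ) (x : E) : E := x + γ

theorem isFlow_shift (Γ : Submodule ℤ E) : IsFlow (shift Γ) where
  zero x := by simp [shift]
  add g h x := by simp [shift]; abel

end Translation

section Lattice

variable {ι : Type*} [Fintype ι] (Γ : Submodule ℤ (ι → ℝ))

theorem measurePreserving_shift (γ : Γ) : MeasurePreserving (shift Γ γ) :=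
  measurePreserving_add_right volume (γ : ι → ℝ)

variable [DiscreteTopology Γ] [IsZLattice ℝ Γ]

theorem exists_bounded_fundamental_set : ∃ F : Set (ι → ℝ), MeasurableSet F ∧
    Bornology.IsBounded F ∧ PacksUnder (shift Γ) F ∧ ∀ x, ∃ γ, shift Γ γ x ∈ F := by
  have : Module.Free ℤ Γ := ZLattice.module_free ℝ Γ
  have : Module.Finite ℤ Γ := ZLattice.module_finite ℝ Γ
  let b₀ := Module.Free.chooseBasis ℤ Γ
  let b := b₀.ofZLatticeBasis ℝ Γ
  have hb : Submodule.span ℤ (Set.range b) = Γ := b₀.ofZLatticeBasis_span ℝ Γ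
  refine ⟨ZSpan.fundamentalDomain b, ZSpan.fundamentalDomain_measurableSet b,
    ZSpan.fundamentalDomain_isBounded b, ?_, ?_⟩
  · intro x hx γ hγ
    rw [← ZSpan.fract_eq_self] at hx hγ
    have : shift Γ γ x = x := by
      rw [← hγ, shift, ZSpan.fract_add_ZSpan b _ (by rw [hb]; exact γ.2), hx]
    simpa [shift] using this
  · intro x
    refine ⟨⟨-(ZSpan.floor b x : ι → ℝ), ?_⟩, ?_⟩
    · exact Γ.neg_mem (hb.le (ZSpan.floor b x).2)
    · have := ZSpan.fract_mem_fundamentalDomain b x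
      rwa [ZSpan.fract_apply, sub_eq_add_neg] at this

/-- A set all of whose translates by a lattice are almost everywhere disjoint has finite measure. -/
theorem volume_lt_top_of_packs {X : Set (ι → ℝ)} (hX : NullMeasurableSet X)
    (hp : ∀ᵐ x, ∑' γ, X.indicator (fun _ => (1 : ℝ≥0∞)) (shift Γ γ x) ≤ 1) : volume X < ⊤ := by
  obtain ⟨F, hF, hFb, -, hc⟩ := exists_bounded_fundamental_set Γ
  exact (measure_le_of_packs (isFlow_shift Γ) (measurePreserving_shift Γ) hX hF hp
    fun x _ => hc x).trans_lt hFb.measure_lt_top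

end Lattice

/-! ### Counting lattice vectors that `A ^ m` keeps short. -/

section Counting

variable {ι : Type*} [Fintype ι]

theorem norm_dil_natCast_le_iff {lam : ι → ℝ} {m : ℕ} {x : ι → ℝ} {R : ℝ} (hR : 0 ≤ R) :
    ‖dil lam m x‖ ≤ R ↔ ∀ i, |lam i| ^ m * |x i| ≤ R := by
  rw [pi_norm_le_iff_of_nonneg hR]
  simp [dil]

variable (Γ : Submodule ℤ (ι → ℝ)) [DiscreteTopology Γ]

theorem finite_lattice_norm_dil_le {lam : ι → ℝ} (h : ∀ i, lam i ≠ 0) (j : ℤ) (R : ℝ) :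
    {x : ι → ℝ | ‖dil lam j x‖ ≤ R ∧ x ∈ Γ}.Finite := by
  have hc : IsClosed (Γ : Set (ι → ℝ)) :=
    AddSubgroup.isClosed_of_discrete (H := Γ.toAddSubgroup)
  have hb : Bornology.IsBounded {x : ι → ℝ | ‖dil lam j x‖ ≤ R} := by
    let f : (ι → ℝ) →ₗ[ℝ] (ι → ℝ) :=
      { toFun := dil lam (-j), map_add' := dil_add lam _, map_smul' := dil_smul lam _ }
    have hf : {x : ι → ℝ | ‖dil lam j x‖ ≤ R} ⊆
        LinearMap.toContinuousLinearMap f '' Metric.closedBall 0 R := by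
      intro x hx
      exact ⟨dil lam j x, by simpa using hx, (isFlow_dil h).neg_apply j x⟩
    exact ((LinearMap.toContinuousLinearMap f).lipschitz.isBounded_image
      Metric.isBounded_closedBall).subset hf
  exact Metric.finite_isBounded_inter_isClosed (s := (Γ : Set (ι → ℝ)))
    (show IsDiscrete _ from ⟨‹_›⟩) hb hc

/-- A nonzero lattice vector of minimal size in its own line. -/
theorem exists_minimal_lattice_vector {lam : ι → ℝ} (h : ∀ i, lam i ≠ 0) (j : ℤ) {R : ℝ}
    (hne : ∃ v ∈ Γ, v ≠ 0 ∧ ‖dil lam j v‖ ≤ R) :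
    ∃ v ∈ Γ, v ≠ 0 ∧ ‖dil lam j v‖ ≤ R ∧
      ∀ t : ℝ, t • v ∈ Γ → |t| < 1 → t = 0 := by
  obtain ⟨v, hv, hmin⟩ := Set.exists_min_image {x : ι → ℝ | (‖dil lam j x‖ ≤ R ∧ x ∈ Γ) ∧ x ≠ 0}
    (fun x => ‖dil lam j x‖)
    ((finite_lattice_norm_dil_le Γ h j R).subset fun _ hx => hx.1)
    (by obtain ⟨v, h1, h2, h3⟩ := hne; exact ⟨v, ⟨h3, h1⟩, h2⟩)
  refine ⟨v, hv.1.2, hv.2, hv.1.1, fun t ht ht1 => ?_⟩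
  by_contra ht0
  have hpos : 0 < ‖dil lam j v‖ := by
    rw [norm_pos_iff]
    intro h0
    apply hv.2
    rw [← (isFlow_dil h).neg_apply j v, h0]
    ext; simp [dil]
  have hlt : ‖dil lam j (t • v)‖ < ‖dil lam j v‖ := by
    rw [dil_smul, norm_smul, Real.norm_eq_abs]
    nlinarith
  exact absurd (hmin (t • v) ⟨⟨hlt.le.trans hv.1.1, ht⟩, smul_ne_zero ht0 hv.2⟩) (not_le.2 hlt)

/-- A change of basis acts linearly on 2×2 minors (on the exterior square), hence with a bound
depending only on `B`. With a lattice basis the new minors of lattice vectors are integers. -/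
theorem abs_minor_repr_le {κ : Type*} [Finite κ] (B : Module.Basis κ ℝ (ι → ℝ)) :
    ∃ c : ℝ, ∀ (K : ℝ) (v w : ι → ℝ), (∀ i j, |v i * w j - v j * w i| ≤ K) →
      ∀ k l, |B.repr v k * B.repr w l - B.repr v l * B.repr w k| ≤ c * K := by
  classical
  have := Fintype.ofFinite κ
  let β : κ → ι → ℝ := fun k i => B.repr (fun j => if i = j then 1 else 0) k
  have hβ : ∀ v k, B.repr v k = ∑ i, v i * β k i := by
    intro v k
    exact (B.coord k).pi_apply_eq_sum_univ v
  refine ⟨∑ k, ∑ l, ∑ i, ∑ j, |β k i * β l j|, fun K v w hK k l => ?_⟩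
  have hsum : B.repr v k * B.repr w l - B.repr v l * B.repr w k =
      ∑ i, ∑ j, β k i * β l j * (v i * w j - v j * w i) := by
    rw [hβ, hβ, hβ, hβ, Finset.sum_mul_sum, mul_comm (∑ i, v i * β l i), Finset.sum_mul_sum,
      ← Finset.sum_sub_distrib]
    refine Finset.sum_congr rfl fun i _ => ?_
    rw [← Finset.sum_sub_distrib]
    exact Finset.sum_congr rfl fun j _ => by ring
  rw [hsum]
  calc |∑ i, ∑ j, β k i * β l j * (v i * w j - v j * w i)|
      ≤ ∑ i, ∑ j, |β k i * β l j| * K := by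
        refine (Finset.abs_sum_le_sum_abs _ _).trans (Finset.sum_le_sum fun i _ => ?_)
        refine (Finset.abs_sum_le_sum_abs _ _).trans (Finset.sum_le_sum fun j _ => ?_)
        rw [abs_mul]
        exact mul_le_mul_of_nonneg_left (hK i j) (abs_nonneg _)
    _ = (∑ i, ∑ j, |β k i * β l j|) * K := by simp only [Finset.sum_mul]
    _ ≤ _ := by
        by_cases hn : Nonempty ι
        · have hK0 : 0 ≤ K := (abs_nonneg _).trans (hK hn.some hn.some)
          refine mul_le_mul_of_nonneg_right ?_ hK0
          refine le_trans ?_ (Finset.single_le_sum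
            (f := fun k => ∑ l, ∑ i, ∑ j, |β k i * β l j|) (fun _ _ => by positivity)
            (Finset.mem_univ k))
          exact Finset.single_le_sum
            (f := fun l => ∑ i, ∑ j, |β k i * β l j|) (fun _ _ => by positivity)
            (Finset.mem_univ l)
        · simp [not_nonempty_iff.1 hn]

variable [IsZLattice ℝ Γ]

/-- If the dilations contract no coordinate plane and every nonzero lattice vector is eventually
expanded, then infinitely many of the sets `{γ ∈ Γ | ‖A ^ m γ‖ ≤ R}` have at most `C` elements. -/
theorem exists_frequently_card_le {lam : ι → ℝ} (h : ∀ i, lam i ≠ 0)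
    (hpair : ∀ i j, i ≠ j → 1 ≤ |lam i * lam j|)
    (hesc : ∀ v ∈ Γ, v ≠ 0 → ∃ i, 1 < |lam i| ∧ v i ≠ 0) {R : ℝ} (hR : 0 < R) :
    ∃ C : ℕ, ∀ M : ℕ, ∃ m ≥ M, ∃ s : Finset (ι → ℝ), s.card ≤ C ∧
      ∀ γ ∈ Γ, ‖dil lam m γ‖ ≤ R → γ ∈ s := by
  classical
  have : Module.Free ℤ Γ := ZLattice.module_free ℝ Γ
  have : Module.Finite ℤ Γ := ZLattice.module_finite ℝ Γ
  let b₀ := Module.Free.chooseBasis ℤ Γ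
  let b := b₀.ofZLatticeBasis ℝ Γ
  have hb : ∀ (x : Γ) k, b.repr x k = b₀.repr x k := b₀.ofZLatticeBasis_repr_apply ℝ Γ
  obtain ⟨c, hc⟩ := abs_minor_repr_le b
  obtain ⟨N, hN⟩ := exists_nat_ge (c * (2 * R ^ 2))
  obtain ⟨L, hL⟩ : ∃ L : ℕ, ∀ i, |lam i| ≤ L := by
    obtain ⟨L, hL⟩ := exists_nat_ge (∑ i, |lam i|)
    exact ⟨L, fun i => (Finset.single_le_sum (f := fun i => |lam i|) (fun _ _ => abs_nonneg _)
      (Finset.mem_univ i)).trans hL⟩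
  let κ := Module.Free.ChooseBasisIndex ℤ Γ
  let S : Finset ((κ → κ → ℤ) × ℤ) :=
    Finset.Icc (fun _ _ => -(N : ℤ)) (fun _ _ => (N : ℤ)) ×ˢ Finset.Icc (-(L : ℤ)) L
  -- `S` does not depend on `M`; the extra 1 leaves room for `{0}` when no nonzero vector is short
  -- at time `M`.
  refine ⟨S.card + 1, fun M => ?_⟩
  by_cases hne : ∃ v ∈ Γ, v ≠ 0 ∧ ‖dil lam M v‖ ≤ R
  swap
  · push Not at hne
    refine ⟨M, le_rfl, {0}, by simp, fun γ hγ hle => ?_⟩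
    by_contra h0
    exact absurd hle (not_le.2 (hne γ hγ (by simpa using h0)))
  obtain ⟨v, hvΓ, hv0, hvR, hvmin⟩ := exists_minimal_lattice_vector Γ h M hne
  -- the last time at which `v` is short
  obtain ⟨m, hmM, hm, hm'⟩ : ∃ m ≥ M, ‖dil lam m v‖ ≤ R ∧ ¬ ‖dil lam (m + 1 : ℕ) v‖ ≤ R := by
    by_contra! hcon
    have hall : ∀ m ≥ M, ‖dil lam m v‖ ≤ R := fun m hm =>
      Nat.le_induction hvR (fun m hm ih => hcon m hm ih) m hm
    obtain ⟨i, hi, hvi⟩ := hesc v hvΓ hv0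
    obtain ⟨k, hk⟩ := pow_unbounded_of_one_lt (R / |v i|) hi
    have h1 := (norm_dil_natCast_le_iff hR.le).1 (hall (max k M) (le_max_right _ _)) i
    have h2 : |lam i| ^ k ≤ |lam i| ^ max k M := pow_le_pow_right₀ hi.le (le_max_left _ _)
    rw [div_lt_iff₀ (abs_pos.2 hvi)] at hk
    nlinarith [abs_pos.2 hvi]
  rw [norm_dil_natCast_le_iff hR.le] at hm hm'
  push Not at hm'
  obtain ⟨i₀, hi₀⟩ := hm'
  -- Since `v` is too long at time `m + 1` and one step expands by at most `L`, its coordinate `i₀`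
  -- already exceeds `R / L` at time `m`.
  have hL0 : R < L * (|lam i₀| ^ m * |v i₀|) := by
    calc R < |lam i₀| ^ (m + 1) * |v i₀| := hi₀
      _ = |lam i₀| * (|lam i₀| ^ m * |v i₀|) := by ring
      _ ≤ _ := mul_le_mul_of_nonneg_right (hL i₀) (by positivity)
  have hLpos : (0 : ℝ) < L := by
    have : 0 ≤ |lam i₀| ^ m * |v i₀| := by positivity
    by_contra hcon
    nlinarith
  let B : Set (ι → ℝ) := {x | ‖dil lam m x‖ ≤ R ∧ x ∈ Γ}
  have hBf : B.Finite := finite_lattice_norm_dil_le Γ h m R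
  -- The minors determine `w` modulo the line of `v`; the floor, at resolution `R / L` in coordinate
  -- `i₀`, separates the short vectors within one such class.
  let Φ : (ι → ℝ) → (κ → κ → ℤ) × ℤ := fun w =>
    (fun k l => ⌊b.repr v k⌋ * ⌊b.repr w l⌋ - ⌊b.repr v l⌋ * ⌊b.repr w k⌋,
      ⌊L * (|lam i₀| ^ m * w i₀) / R⌋)
  have hfl : ∀ w ∈ Γ, ∀ k, ((⌊b.repr w k⌋ : ℤ) : ℝ) = b.repr w k := by
    intro w hw k
    have := hb ⟨w, hw⟩ k
    simp only at this
    rw [this]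
    simp
  refine ⟨m, hmM, hBf.toFinset, ?_, fun γ hγ hle => by simpa [B] using ⟨hle, hγ⟩⟩
  refine le_trans (Finset.card_le_card_of_injOn (t := S) Φ ?_ ?_) (Nat.le_succ _)
  · intro w hw
    have hw : ‖dil lam m w‖ ≤ R ∧ w ∈ Γ := by simpa [B] using hw
    obtain ⟨hwR, hwΓ⟩ := hw
    rw [norm_dil_natCast_le_iff hR.le] at hwR
    have hminor : ∀ i j, |v i * w j - v j * w i| ≤ 2 * R ^ 2 := by
      have h1 : ∀ i j, i ≠ j → |v i * w j| ≤ R ^ 2 := by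
        intro i j hij
        have e : |lam i * lam j| ^ m * |v i * w j| =
            (|lam i| ^ m * |v i|) * (|lam j| ^ m * |w j|) := by
          rw [abs_mul, abs_mul]; ring
        have h2 : 1 ≤ |lam i * lam j| ^ m := one_le_pow₀ (hpair i j hij)
        calc |v i * w j| ≤ |lam i * lam j| ^ m * |v i * w j| :=
              le_mul_of_one_le_left (abs_nonneg _) h2
          _ = _ := e
          _ ≤ R * R := mul_le_mul (hm i) (hwR j) (by positivity) hR.le
          _ = R ^ 2 := by ring
      intro i j
      by_cases hij : i = j
      · subst hij
        simp only [sub_self, abs_zero]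
        positivity
      · calc |v i * w j - v j * w i| ≤ |v i * w j| + |v j * w i| := abs_sub _ _
          _ ≤ _ := by linarith [h1 i j hij, h1 j i (Ne.symm hij)]
    have hint : ∀ k l, |⌊b.repr v k⌋ * ⌊b.repr w l⌋ - ⌊b.repr v l⌋ * ⌊b.repr w k⌋| ≤ (N : ℤ) := by
      intro k l
      have := (hc _ v w hminor k l).trans hN
      rw [← Int.cast_le (R := ℝ)]
      push_cast
      rwa [hfl v hvΓ, hfl v hvΓ, hfl w hwΓ, hfl w hwΓ]
    have habs : |L * (|lam i₀| ^ m * w i₀) / R| ≤ L := by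
      rw [abs_div, abs_mul, abs_mul, abs_pow, abs_abs, abs_of_pos hR, div_le_iff₀ hR,
        abs_of_pos hLpos]
      exact mul_le_mul_of_nonneg_left (hwR i₀) hLpos.le
    rw [abs_le] at habs
    simp only [S, Φ, Finset.coe_product, Set.mem_prod, Finset.coe_Icc, Set.mem_Icc, Pi.le_def]
    refine ⟨⟨fun k l => (abs_le.1 (hint k l)).1, fun k l => (abs_le.1 (hint k l)).2⟩, ?_, ?_⟩
    · rw [Int.le_floor]
      push_cast
      exact habs.1
    · have := (Int.floor_le _).trans habs.2
      exact_mod_cast this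
  · intro w hw w' hw' hΦ
    have hw : ‖dil lam m w‖ ≤ R ∧ w ∈ Γ := by simpa [B] using hw
    have hw' : ‖dil lam m w'‖ ≤ R ∧ w' ∈ Γ := by simpa [B] using hw'
    simp only [Φ, Prod.mk.injEq] at hΦ
    obtain ⟨hmin, hflo⟩ := hΦ
    have hpar : ∀ k l, b.repr v k * b.repr (w - w') l = b.repr v l * b.repr (w - w') k := by
      intro k l
      have := congrArg (Int.cast : ℤ → ℝ) (congrFun (congrFun hmin k) l)
      push_cast at this
      rw [hfl v hvΓ, hfl v hvΓ, hfl w hw.2, hfl w hw.2, hfl w' hw'.2, hfl w' hw'.2] at this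
      simp only [map_sub, Finsupp.sub_apply]
      linarith
    obtain ⟨k, hk⟩ : ∃ k, b.repr v k ≠ 0 := by
      by_contra! hcon
      exact hv0 (b.repr.map_eq_zero_iff.1 (Finsupp.ext hcon))
    obtain ⟨t, htv⟩ : ∃ t : ℝ, t • v = w - w' := by
      refine ⟨b.repr (w - w') k / b.repr v k, b.repr.injective (Finsupp.ext fun l => ?_)⟩
      rw [map_smul, Finsupp.smul_apply, smul_eq_mul, div_mul_eq_mul_div, div_eq_iff hk]
      linarith [hpar k l]
    -- Equal floors bound `|t|` times a quantity exceeding 1 by `hL0`, so `|t| < 1` and minimality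
    -- of `v` applies.
    have ht0 : t = 0 := by
      refine hvmin t (by rw [htv]; exact Γ.sub_mem hw.2 hw'.2) ?_
      have h1 := Int.abs_sub_lt_one_of_floor_eq_floor hflo
      have h2 : L * (|lam i₀| ^ m * w i₀) / R - L * (|lam i₀| ^ m * w' i₀) / R =
          t * (L * (|lam i₀| ^ m * v i₀) / R) := by
        have := congrFun htv i₀
        simp only [Pi.smul_apply, smul_eq_mul, Pi.sub_apply] at this
        rw [← sub_div, ← mul_sub, ← mul_sub, ← this]
        ring
      rw [h2, abs_mul, abs_div, abs_mul, abs_mul, abs_pow, abs_abs, abs_of_pos hR,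
        abs_of_pos hLpos] at h1
      have h3 : 1 < L * (|lam i₀| ^ m * |v i₀|) / R := by rwa [one_lt_div hR]
      nlinarith [abs_nonneg t]
    rw [ht0, zero_smul] at htv
    exact (sub_eq_zero.1 htv.symm)

end Counting

/-! ### A translation packing whose dilates cover. -/

section Covering

open Filter Topology

variable {ι : Type*} [Fintype ι] (Γ : Submodule ℤ (ι → ℝ)) [DiscreteTopology Γ] [IsZLattice ℝ Γ]

/-- Take one point from each `Γ`-orbit met by the preimage of `E` under `A ^ m`. Two points of `E`
differ by at most `2 * R` in norm, so the translates of `P` by `A ^ m γ` with `γ ∈ s` cover `E`. -/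
theorem exists_packing_part {lam : ι → ℝ} (h : ∀ i, lam i ≠ 0) {E : Set (ι → ℝ)} {R : ℝ}
    (hE : MeasurableSet E) (hER : E ⊆ Metric.closedBall 0 R) (m : ℤ) (s : Finset (ι → ℝ))
    (hs : ∀ γ ∈ Γ, ‖dil lam m γ‖ ≤ 2 * R → γ ∈ s) :
    ∃ P ⊆ E, MeasurableSet P ∧ volume E ≤ s.card * volume P ∧
      PacksUnder (shift Γ) (dil lam m ⁻¹' P) := by
  obtain ⟨F, hF, -, hFp, hFc⟩ := exists_bounded_fundamental_set Γ
  obtain ⟨Q, hQE, hQ, hQp, hQc⟩ := exists_packing_subset (isFlow_shift Γ)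
    (fun γ => (measurePreserving_shift Γ γ).measurable) hF (measurable_dil lam m hE) hFp
    fun x _ => hFc x
  have hfl := isFlow_dil h
  have hQ' : dil lam m ⁻¹' (dil lam (-m) ⁻¹' Q) = Q := by
    ext x
    simp [hfl.neg_apply]
  refine ⟨dil lam (-m) ⁻¹' Q, fun x hx => ?_, measurable_dil lam _ hQ, ?_, by rwa [hQ']⟩
  · have := hQE hx
    rwa [Set.mem_preimage, hfl.apply_neg] at this
  · have hsub : E ⊆ ⋃ γ ∈ s, (fun x => x + dil lam m γ) ⁻¹' (dil lam (-m) ⁻¹' Q) := by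
      intro x hx
      obtain ⟨γ, hγ⟩ := hQc (dil lam (-m) x) (by rwa [Set.mem_preimage, hfl.apply_neg])
      have hadd : dil lam m (shift Γ γ (dil lam (-m) x)) = x + dil lam m γ := by
        rw [shift, dil_add, hfl.apply_neg]
      refine Set.mem_biUnion (x := (γ : ι → ℝ)) (hs γ γ.2 ?_) ?_
      · have h1 := hER hx
        have h2 := hER (hQE hγ)
        rw [mem_closedBall_zero_iff] at h1 h2
        have h3 : dil lam m γ = dil lam m (shift Γ γ (dil lam (-m) x)) - x := by
          rw [hadd]; abel
        rw [h3]
        exact (norm_sub_le _ _).trans (by linarith)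
      · rw [Set.mem_preimage, Set.mem_preimage, ← hadd, hfl.neg_apply]
        exact hγ
    calc volume E ≤ ∑ γ ∈ s, volume ((fun x => x + dil lam m γ) ⁻¹' (dil lam (-m) ⁻¹' Q)) :=
          (measure_mono hsub).trans (measure_biUnion_finset_le _ _)
      _ = s.card * volume (dil lam (-m) ⁻¹' Q) := by
          simp [measure_preimage_add_right]

theorem tendsto_ofReal_zpow_neg {d : ℝ} (hd : 1 < d) :
    Tendsto (fun m : ℕ => ENNReal.ofReal (d ^ (-(m : ℤ)))) atTop (𝓝 0) := by
  have : (fun m : ℕ => ENNReal.ofReal (d ^ (-(m : ℤ)))) = fun m => ENNReal.ofReal d⁻¹ ^ m := by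
    ext m
    rw [zpow_neg, zpow_natCast, ← inv_pow, ENNReal.ofReal_pow (by positivity)]
  rw [this]
  refine ENNReal.tendsto_pow_atTop_nhds_zero_of_lt_one ?_
  rw [ENNReal.ofReal_lt_one]
  exact inv_lt_one_of_one_lt₀ hd

/-- If `E k` has measure at most `c` times that of `P k ⊆ E k`, where `E k` is the part of a bounded
set that the earlier `P l` have missed, for infinitely many `k`, then nothing is missed forever. -/
theorem measure_missed_eq_zero {Ω : Type*} [MeasurableSpace Ω] {μ : Measure Ω} {B : Set Ω}
    (hB : μ B ≠ ⊤) {P : ℕ → Set Ω} (hP : ∀ k, MeasurableSet (P k)) {c : ℝ≥0∞} (hc : c ≠ ⊤) {s : ℕ}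
    {k : ℕ → ℕ} (hk : Function.Injective k) (hks : ∀ t, s ≤ k t)
    (hsub : ∀ t, P (k t) ⊆ B \ ⋃ l ∈ Finset.Ico s (k t), P l)
    (hle : ∀ t, μ (B \ ⋃ l ∈ Finset.Ico s (k t), P l) ≤ c * μ (P (k t))) :
    μ (B \ ⋃ l ≥ s, P l) = 0 := by
  have hdisj : Pairwise (Function.onFun Disjoint fun t => P (k t)) := by
    have key : ∀ t t', k t < k t' → Disjoint (P (k t)) (P (k t')) := by
      intro t t' hlt
      refine Set.disjoint_left.2 fun x hx hx' => (hsub t' hx').2 ?_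
      exact Set.mem_biUnion (Finset.mem_coe.2 (Finset.mem_Ico.2 ⟨hks t, hlt⟩)) hx
    intro t t' hne
    rcases lt_or_gt_of_ne (hk.ne hne) with hlt | hlt
    · exact key t t' hlt
    · exact (key t' t hlt).symm
  have hsum : ∑' t, μ (P (k t)) ≠ ⊤ := by
    rw [← measure_iUnion hdisj fun t => hP _]
    exact ((measure_mono (Set.iUnion_subset fun t => (hsub t).trans Set.sdiff_subset)).trans_lt
      hB.lt_top).ne
  have hlim := ENNReal.Tendsto.const_mul (a := c) (ENNReal.tendsto_atTop_zero_of_tsum_ne_top hsum)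
    (Or.inr hc)
  rw [mul_zero] at hlim
  refine le_antisymm (ge_of_tendsto' hlim fun t => (measure_mono ?_).trans (hle t)) zero_le
  refine Set.sdiff_subset_sdiff_right (Set.iUnion₂_subset fun l hl => ?_)
  exact Set.subset_biUnion_of_mem (u := fun l => P l) (Finset.mem_Ico.1 hl).1

theorem exists_covering_sequence {lam : ι → ℝ} (h : ∀ i, lam i ≠ 0) (hd : 1 < |∏ i, lam i|)
    (hcount : ∀ R : ℝ, 0 < R → ∃ C : ℕ, ∀ M : ℕ, ∃ m ≥ M, ∃ s : Finset (ι → ℝ), s.card ≤ C ∧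
      ∀ γ ∈ Γ, ‖dil lam m γ‖ ≤ R → γ ∈ s) :
    ∃ (m : ℕ → ℕ) (P : ℕ → Set (ι → ℝ)), (∀ k, MeasurableSet (P k)) ∧
      (∀ k, PacksUnder (shift Γ) (dil lam (m k) ⁻¹' P k)) ∧
      (∀ k, ∀ l < k, ENNReal.ofReal (|∏ i, lam i| ^ (m l)) * volume (dil lam (m k) ⁻¹' P k) ≤
        2⁻¹ ^ l * 2⁻¹ ^ k) ∧
      ∀ᵐ x, ∃ᶠ k in atTop, x ∈ P k := by
  choose C hC using fun r : ℕ => hcount (2 * (r + 1)) (by positivity)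
  -- Decoding `k` as a triple treats each pair (radius, starting index) at infinitely many stages
  -- `k`.
  let r : ℕ → ℕ := fun k => k.unpair.1
  let s : ℕ → ℕ := fun k => k.unpair.2.unpair.1
  let E : ℕ → (ℕ → ℕ × Set (ι → ℝ)) → Set (ι → ℝ) := fun k f =>
    Metric.closedBall 0 (r k + 1) \ ⋃ l ∈ Finset.Ico (s k) k, (f l).2
  obtain ⟨f, hf⟩ : ∃ f : ℕ → ℕ × Set (ι → ℝ), ∀ k, MeasurableSet (f k).2 ∧
      PacksUnder (shift Γ) (dil lam (f k).1 ⁻¹' (f k).2) ∧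
      (∀ l < k, ENNReal.ofReal (|∏ i, lam i| ^ (f l).1) *
        volume (dil lam (f k).1 ⁻¹' (f k).2) ≤ 2⁻¹ ^ l * 2⁻¹ ^ k) ∧
      (f k).2 ⊆ E k f ∧ volume (E k f) ≤ C (r k) * volume (f k).2 := by
    refine exists_seq_of_history (α := ℕ × Set (ι → ℝ)) (fun k f a =>
      MeasurableSet a.2 ∧ PacksUnder (shift Γ) (dil lam a.1 ⁻¹' a.2) ∧
      (∀ l < k, ENNReal.ofReal (|∏ i, lam i| ^ (f l).1) * volume (dil lam a.1 ⁻¹' a.2) ≤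
        2⁻¹ ^ l * 2⁻¹ ^ k) ∧
      a.2 ⊆ E k f ∧ volume (E k f) ≤ C (r k) * volume a.2) ?_ ?_
    · rintro k f g a hfg ⟨h1, h2, h3, h4⟩
      have hE : E k f = E k g := by
        simp only [E]
        congr 1
        refine Set.iUnion₂_congr fun l hl => ?_
        rw [hfg l (Finset.mem_Ico.1 hl).2]
      rw [hE] at h4
      exact ⟨h1, h2, fun l hl => hfg l hl ▸ h3 l hl, h4⟩
    · intro k f hf
      have hEm : MeasurableSet (E k f) := Metric.isClosed_closedBall.measurableSet.diff
        (Finset.measurableSet_biUnion _ fun l hl => (hf l (Finset.mem_Ico.1 hl).2).1)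
      -- Pulling back by `A ^ m` divides volume by `|det A| ^ m`, so a large `m` beats the finitely
      -- many earlier constraints.
      have hsmall : ∀ᶠ m : ℕ in atTop, ∀ l ∈ Finset.range k,
          ENNReal.ofReal (|∏ i, lam i| ^ (f l).1) * (ENNReal.ofReal (|∏ i, lam i| ^ (-(m : ℤ))) *
            volume (Metric.closedBall (0 : ι → ℝ) (r k + 1))) ≤ 2⁻¹ ^ l * 2⁻¹ ^ k := by
        rw [Filter.eventually_all_finset]
        intro l _
        have hlim := ENNReal.Tendsto.const_mul (a := ENNReal.ofReal (|∏ i, lam i| ^ (f l).1))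
          (ENNReal.Tendsto.mul_const (b := volume (Metric.closedBall (0 : ι → ℝ) (r k + 1)))
            (tendsto_ofReal_zpow_neg hd) (Or.inr measure_closedBall_lt_top.ne))
          (Or.inr ENNReal.ofReal_ne_top)
        rw [zero_mul, mul_zero] at hlim
        refine hlim.eventually_le_const (pos_iff_ne_zero.2 (mul_ne_zero ?_ ?_)) <;>
          exact pow_ne_zero _ (by simp)
      obtain ⟨M, hM⟩ := eventually_atTop.1 hsmall
      obtain ⟨m, hm, S, hS, hSm⟩ := hC (r k) M
      obtain ⟨P, hPE, hP, hvol, hpack⟩ := exists_packing_part Γ h hEm Set.sdiff_subset m S hSm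
      refine ⟨(m, P), hP, hpack, fun l hl => ?_, hPE, hvol.trans (by gcongr)⟩
      refine le_trans ?_ (hM m hm l (Finset.mem_range.2 hl))
      rw [volume_preimage_dil h]
      gcongr
      exact hPE.trans Set.sdiff_subset
  refine ⟨fun k => (f k).1, fun k => (f k).2, fun k => (hf k).1, fun k => (hf k).2.1,
    fun k => (hf k).2.2.1, ?_⟩
  have hnull : ∀ a b : ℕ, volume (Metric.closedBall (0 : ι → ℝ) (a + 1) \
      ⋃ l ≥ b, (f l).2) = 0 := by
    intro a b
    let k : ℕ → ℕ := fun t => Nat.pair a (Nat.pair b t)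
    have hr : ∀ t, r (k t) = a := fun t => by simp [r, k]
    have hsk : ∀ t, s (k t) = b := fun t => by simp [s, k]
    refine measure_missed_eq_zero (k := k) (c := C a) measure_closedBall_lt_top.ne
      (fun l => (hf l).1) (ENNReal.natCast_ne_top _) ?_ ?_ ?_ ?_
    · intro t t' ht
      simpa [k, Nat.pair_eq_pair] using ht
    · exact fun t => (Nat.left_le_pair b t).trans (Nat.right_le_pair a _)
    · intro t
      have := (hf (k t)).2.2.2.1
      simpa only [E, hr, hsk] using this
    · intro t
      have := (hf (k t)).2.2.2.2
      simpa only [E, hr, hsk] using this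
  have hae : ∀ᵐ x, ∀ a b : ℕ, x ∉ Metric.closedBall (0 : ι → ℝ) (a + 1) \ ⋃ l ≥ b, (f l).2 :=
    ae_all_iff.2 fun a => ae_all_iff.2 fun b => measure_eq_zero_iff_ae_notMem.1 (hnull a b)
  filter_upwards [hae] with x hx
  rw [frequently_atTop]
  intro b
  obtain ⟨a, ha⟩ := exists_nat_ge ‖x‖
  by_contra! hcon
  refine hx a b ⟨by simpa using by linarith, ?_⟩
  simpa using hcon

theorem exists_packing_covering {lam : ι → ℝ} (h : ∀ i, lam i ≠ 0) (hd : 1 < |∏ i, lam i|)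
    (hcount : ∀ R : ℝ, 0 < R → ∃ C : ℕ, ∀ M : ℕ, ∃ m ≥ M, ∃ s : Finset (ι → ℝ), s.card ≤ C ∧
      ∀ γ ∈ Γ, ‖dil lam m γ‖ ≤ R → γ ∈ s) :
    ∃ V : Set (ι → ℝ), MeasurableSet V ∧ PacksUnder (shift Γ) V ∧ ∀ᵐ x, ∃ j, dil lam j x ∈ V := by
  obtain ⟨m, P, hP, hpack, hsmall, hfreq⟩ := exists_covering_sequence Γ h hd hcount
  have hfl := isFlow_dil h
  let Q : ℕ → Set (ι → ℝ) := fun k => dil lam (m k) ⁻¹' P k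
  have hQ : ∀ k, MeasurableSet (Q k) := fun k => measurable_dil lam _ (hP k)
  let O : ℕ → Set (ι → ℝ) := fun l => ⋃ γ, shift Γ γ ⁻¹' Q l
  have hO : ∀ k, MeasurableSet (O k) := fun k =>
    MeasurableSet.iUnion fun γ => (measurePreserving_shift Γ γ).measurable (hQ k)
  -- Later sets take priority: from each `Q k`, remove the `Γ`-saturations of all later `Q l`.
  refine ⟨⋃ k, Q k \ ⋃ l > k, O l, MeasurableSet.iUnion fun k => (hQ k).diff
    (MeasurableSet.iUnion fun l => MeasurableSet.iUnion fun _ => hO l), ?_, ?_⟩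
  · intro x hx γ hγ
    obtain ⟨k, hk, hk'⟩ := Set.mem_iUnion.1 hx
    obtain ⟨l, hl, hl'⟩ := Set.mem_iUnion.1 hγ
    rcases lt_trichotomy k l with hkl | hkl | hkl
    · exact absurd (Set.mem_biUnion (show l > k from hkl) (Set.mem_iUnion.2 ⟨γ, hl⟩)) hk'
    · subst hkl
      exact hpack k x hk γ hl
    · refine absurd (Set.mem_biUnion (show k > l from hkl) (Set.mem_iUnion.2 ⟨-γ, ?_⟩)) hl'
      rwa [Set.mem_preimage, (isFlow_shift Γ).neg_apply]
  · have hB : ∀ k l, k < l → volume (P k ∩ dil lam (-(m k : ℤ)) ⁻¹' O l) ≤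
        2⁻¹ ^ k * 2⁻¹ ^ l := by
      intro k l hkl
      have e : P k ∩ dil lam (-(m k : ℤ)) ⁻¹' O l = dil lam (-(m k : ℤ)) ⁻¹' (Q k ∩ O l) := by
        ext x
        simp [Q, hfl.apply_neg]
      rw [e, volume_preimage_dil h, neg_neg, zpow_natCast]
      refine le_trans ?_ (hsmall l k hkl)
      refine mul_le_mul_right ?_ _
      refine measure_le_of_packs (isFlow_shift Γ) (measurePreserving_shift Γ)
        ((hQ k).inter (hO l)).nullMeasurableSet (hQ l) ?_ fun x hx => Set.mem_iUnion.1 hx.2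
      exact Filter.Eventually.of_forall fun x =>
        ((hpack k).mono Set.inter_subset_left).tsum_indicator_le (isFlow_shift Γ) x
    -- Borel–Cantelli: almost every point lies in infinitely many `P k`, but in the damaged part of
    -- only finitely many.
    have hBC : ∀ᵐ x, ∀ᶠ k in atTop, x ∉ ⋃ l > k, P k ∩ dil lam (-(m k : ℤ)) ⁻¹' O l := by
      refine ae_eventually_notMem (ne_top_of_le_ne_top (b := ∑' k : ℕ, ∑' l : ℕ,
        (2⁻¹ ^ k * 2⁻¹ ^ l : ℝ≥0∞)) ?_ (ENNReal.tsum_le_tsum fun k => ?_))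
      · simp_rw [ENNReal.tsum_mul_left, ENNReal.tsum_mul_right, ENNReal.tsum_geometric]
        simpa using ENNReal.mul_ne_top ENNReal.ofNat_ne_top ENNReal.ofNat_ne_top
      · refine (measure_iUnion_le _).trans (ENNReal.tsum_le_tsum fun l => ?_)
        by_cases hkl : k < l
        · simpa [hkl] using hB k l hkl
        · simp [hkl]
    filter_upwards [hfreq, hBC] with x hx hx'
    obtain ⟨k, hk, hk'⟩ := (hx.and_eventually hx').exists
    refine ⟨-(m k : ℤ), Set.mem_iUnion.2 ⟨k, ?_, ?_⟩⟩
    · simpa [Q, hfl.apply_neg] using hk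
    · intro hmem
      obtain ⟨l, hl, hmem⟩ := Set.mem_iUnion₂.1 hmem
      exact hk' (Set.mem_iUnion₂.2 ⟨l, hl, hk, hmem⟩)

end Covering

/-! ### The two sets fed to Cantor–Bernstein. -/

section Existence

variable {ι : Type*}

theorem packsUnder_dil_shell {lam : ι → ℝ} {i : ι} (hi : 1 < |lam i|) {R : ℝ} (hR : 0 < R) :
    PacksUnder (dil lam) {x | R ≤ |x i| ∧ |x i| < R * |lam i|} := by
  intro x hx j hj
  simp only [Set.mem_ofPred_eq, dil, abs_mul, abs_zpow] at hx hj
  by_contra hj0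
  rcases lt_or_gt_of_ne hj0 with h | h
  · have h1 : |lam i| ^ j ≤ |lam i| ^ (-1 : ℤ) := zpow_le_zpow_right₀ hi.le (by omega)
    rw [zpow_neg_one] at h1
    have h2 : R ≤ |lam i|⁻¹ * |x i| := hj.1.trans (by gcongr)
    rw [← div_eq_inv_mul, le_div_iff₀ (by linarith)] at h2
    linarith
  · have h1 : |lam i| ^ (1 : ℤ) ≤ |lam i| ^ j := zpow_le_zpow_right₀ hi.le (by omega)
    rw [zpow_one] at h1
    nlinarith

theorem exists_dil_mem_shell {lam : ι → ℝ} {i : ι} (hi : 1 < |lam i|) {x : ι → ℝ} (hx : x i ≠ 0) :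
    ∃ j, dil lam j x ∈ {x : ι → ℝ | 1 ≤ |x i| ∧ |x i| < 1 * |lam i|} := by
  obtain ⟨n, hn1, hn2⟩ := exists_mem_Ico_zpow (abs_pos.2 hx) hi
  have hpos : 0 < |lam i| := by linarith
  refine ⟨-n, ?_⟩
  simp only [Set.mem_ofPred_eq, dil, abs_mul, abs_zpow]
  rw [zpow_neg]
  rw [← div_eq_inv_mul, one_le_div (zpow_pos hpos n), div_lt_iff₀ (zpow_pos hpos n), one_mul,
    ← zpow_one_add₀ hpos.ne', add_comm]
  exact ⟨hn1, hn2⟩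

theorem measurableSet_shell (i : ι) (a b : ℝ) :
    MeasurableSet {x : ι → ℝ | a ≤ |x i| ∧ |x i| < b} := by
  have h : Measurable fun x : ι → ℝ => |x i| := (measurable_pi_apply i).norm
  exact (measurableSet_le measurable_const h).inter (measurableSet_lt h measurable_const)

variable [Fintype ι] (Γ : Submodule ℤ (ι → ℝ)) [DiscreteTopology Γ] [IsZLattice ℝ Γ]

theorem exists_dil_packing_shift_tile {lam : ι → ℝ} {i : ι} (hi : 1 < |lam i|) :
    ∃ U : Set (ι → ℝ), MeasurableSet U ∧ PacksUnder (dil lam) U ∧ PacksUnder (shift Γ) U ∧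
      ∀ x, ∃ γ, shift Γ γ x ∈ U := by
  obtain ⟨F, hF, hFb, hFp, hFc⟩ := exists_bounded_fundamental_set Γ
  obtain ⟨ρ, hρ, hFρ⟩ := hFb.subset_closedBall_lt 0 0
  obtain ⟨R, hR, hR'⟩ : ∃ R : ℝ, 0 < R ∧ R + 2 * ρ < R * |lam i| := by
    -- `R` is large enough for one dilation shell in coordinate `i` to contain an interval of length
    -- `2 * ρ`, the width of the shifted cell.
    refine ⟨(2 * ρ + 1) / (|lam i| - 1), div_pos (by linarith) (by linarith), ?_⟩
    have : (2 * ρ + 1) / (|lam i| - 1) * (|lam i| - 1) = 2 * ρ + 1 :=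
      div_mul_cancel₀ _ (by linarith)
    linarith
  let v : ι → ℝ := fun _ => R + ρ
  refine ⟨(fun x => x - v) ⁻¹' F, hF.preimage (by fun_prop), ?_, ?_, ?_⟩
  · refine (packsUnder_dil_shell hi hR).mono fun x hx => ?_
    have h1 := hFρ hx
    rw [mem_closedBall_zero_iff] at h1
    have h2 := (norm_le_pi_norm (x - v) i).trans h1
    rw [Pi.sub_apply, Real.norm_eq_abs, abs_le] at h2
    have h3 : 0 < x i := by simp only [v] at h2; linarith
    simp only [Set.mem_ofPred_eq, abs_of_pos h3]
    simp only [v] at h2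
    constructor <;> linarith
  · intro x hx γ hγ
    refine hFp _ hx γ ?_
    simpa only [Set.mem_preimage, shift, add_sub_right_comm] using hγ
  · intro x
    obtain ⟨γ, hγ⟩ := hFc (x - v)
    refine ⟨γ, ?_⟩
    simpa only [Set.mem_preimage, shift, add_sub_right_comm] using hγ

/-- The shell in coordinate `i` meets each dilation orbit off the hyperplane `x i = 0` exactly once,
so `V` can be thinned to one point per orbit. -/
theorem exists_dil_tile_shift_packing {lam : ι → ℝ} (h : ∀ i, lam i ≠ 0)
    (hd : 1 < |∏ i, lam i|) {i : ι} (hi : 1 < |lam i|)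
    (hcount : ∀ R : ℝ, 0 < R → ∃ C : ℕ, ∀ M : ℕ, ∃ m ≥ M, ∃ s : Finset (ι → ℝ), s.card ≤ C ∧
      ∀ γ ∈ Γ, ‖dil lam m γ‖ ≤ R → γ ∈ s) :
    ∃ V : Set (ι → ℝ), MeasurableSet V ∧ PacksUnder (dil lam) V ∧ PacksUnder (shift Γ) V ∧
      ∀ᵐ x, ∃ j, dil lam j x ∈ V := by
  obtain ⟨V, hV, hVp, hVc⟩ := exists_packing_covering Γ h hd hcount
  have hfl := isFlow_dil h
  obtain ⟨P, hPX, hP, hPp, hPc⟩ := exists_packing_subset hfl (measurable_dil lam)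
    (measurableSet_shell i 1 (1 * |lam i|))
    (hV.inter (measurable_pi_apply i (measurableSet_singleton (0 : ℝ)).compl))
    (packsUnder_dil_shell hi one_pos) fun x hx => exists_dil_mem_shell hi hx.2
  refine ⟨P, hP, hPp, hVp.mono (hPX.trans Set.inter_subset_left), ?_⟩
  have h0 : ∀ᵐ x : ι → ℝ, x i ≠ 0 := Measure.ae_eval_ne (fun _ : ι => (volume : Measure ℝ)) i 0
  filter_upwards [hVc, h0] with x ⟨j, hj⟩ hx
  obtain ⟨k, hk⟩ := hPc (dil lam j x) ⟨hj, mul_ne_zero (zpow_ne_zero _ (h i)) hx⟩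
  exact ⟨k + j, by rwa [hfl.add]⟩

end Existence

/-! ### Lattice vectors on a contracting axis. -/

section Obstruction

variable {ι : Type*} [Fintype ι] (Γ : Submodule ℤ (ι → ℝ))

/-- `A ^ m W` packs by multiples of `A ^ m v`, a vector along axis `i` of length `|lam i| ^ m * |v
i|`. Modulo these multiples its part in the box fits into a slab of that thickness. -/
theorem volume_box_inter_preimage_dil_le {lam : ι → ℝ} (h : ∀ i, lam i ≠ 0) {W : Set (ι → ℝ)}
    (hW : NullMeasurableSet W)
    (hp : ∀ᵐ x, ∑' γ, W.indicator (fun _ => (1 : ℝ≥0∞)) (shift Γ γ x) ≤ 1) {i : ι} {v : ι → ℝ}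
    (hv : v ∈ Γ) (hvi : v i ≠ 0) (hv0 : ∀ k ≠ i, v k = 0) (m : ℕ) (r : ℝ) :
    volume ((Set.univ.pi fun _ => Set.Icc (-r) r) ∩ dil lam (-(m : ℤ)) ⁻¹' W) ≤
      ENNReal.ofReal (|lam i| ^ m * |v i|) * ENNReal.ofReal (2 * r) ^ (Fintype.card ι - 1) := by
  classical
  have hfl := isFlow_dil h
  set u := dil lam m v with hu
  set c := |lam i| ^ m * |v i| with hc
  have hc0 : 0 < c := by have := abs_pos.2 hvi; have := abs_pos.2 (h i); positivity
  have hui : |u i| = c := by simp [hu, hc, dil, abs_mul]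
  have hu0 : ∀ k ≠ i, u k = 0 := fun k hk => by simp [hu, dil, hv0 k hk]
  let T : ℤ → (ι → ℝ) → ι → ℝ := fun k x => x + k • u
  have hT : IsFlow T := ⟨fun x => by simp [T], fun g k x => by simp only [T, add_smul]; abel⟩
  let Y : Set (ι → ℝ) := Set.univ.pi fun k => if k = i then Set.Ico 0 c else Set.Icc (-r) r
  have hY : MeasurableSet Y := MeasurableSet.univ_pi fun k => by
    split_ifs
    · exact measurableSet_Ico
    · exact measurableSet_Icc
  have hvol : volume Y = ENNReal.ofReal c * ENNReal.ofReal (2 * r) ^ (Fintype.card ι - 1) := by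
    rw [volume_pi_pi, ← Finset.mul_prod_erase _ _ (Finset.mem_univ i)]
    congr 1
    · simp
    · rw [Finset.prod_congr rfl (g := fun _ => ENNReal.ofReal (2 * r)), Finset.prod_const,
        Finset.card_erase_of_mem (Finset.mem_univ i), Finset.card_univ]
      intro k hk
      rw [if_neg (Finset.ne_of_mem_erase hk), Real.volume_Icc]
      congr 1
      ring
  rw [← hvol]
  refine measure_le_of_packs hT (fun k => measurePreserving_add_right volume (k • u))
    (NullMeasurableSet.inter (MeasurableSet.univ_pi fun _ => measurableSet_Icc).nullMeasurableSet
      (hW.preimage (quasiMeasurePreserving_dil h _))) hY ?_ ?_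
  · filter_upwards [(quasiMeasurePreserving_dil h (-(m : ℤ))).ae hp] with x hx
    let e : ℤ → Γ := fun k => k • ⟨v, hv⟩
    have he : Function.Injective e := by
      intro a b hab
      have := congrFun (congrArg Subtype.val hab) i
      simpa [e, hvi] using this
    refine le_trans ?_ ((ENNReal.tsum_comp_le_tsum_of_injective he _).trans hx)
    refine ENNReal.tsum_le_tsum fun k => ?_
    have hk : dil lam (-(m : ℤ)) (T k x) = shift Γ (e k) (dil lam (-(m : ℤ)) x) := by
      have : (k • u : ι → ℝ) = dil lam m (k • v) := by
        ext a; simp [hu, dil]; ring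
      simp only [T, dil_add, shift, this, hfl.neg_apply, e]
      rfl
    rw [← hk]
    by_cases hmem : T k x ∈ (Set.univ.pi fun _ => Set.Icc (-r) r) ∩ dil lam (-(m : ℤ)) ⁻¹' W
    · rw [Set.indicator_of_mem hmem, Set.indicator_of_mem (show dil lam _ (T k x) ∈ W from hmem.2)]
    · rw [Set.indicator_of_notMem hmem]
      exact zero_le
  · rintro x ⟨hx, -⟩
    obtain ⟨k, hk, -⟩ := existsUnique_add_zsmul_mem_Ico hc0 (x i) 0
    have hmem : ∀ k' : ℤ, k' • u i = k • c → T k' x ∈ Y := by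
      intro k' hk' a _
      by_cases ha : a = i
      · subst ha
        simpa [T, ← hk'] using hk
      · simpa [T, ha, hu0 a ha] using hx a (Set.mem_univ a)
    rcases abs_choice (u i) with hs | hs
    · exact ⟨k, hmem k (by rw [← hui, hs])⟩
    · exact ⟨-k, hmem (-k) (by rw [← hui, hs]; simp)⟩

variable [DiscreteTopology Γ] [IsZLattice ℝ Γ]

theorem not_covers_of_contracting_lattice_vector {lam : ι → ℝ} (h : ∀ i, lam i ≠ 0)
    (hd : 1 < |∏ i, lam i|) {W : Set (ι → ℝ)} (hW : NullMeasurableSet W)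
    (hp : ∀ᵐ x, ∑' γ, W.indicator (fun _ => (1 : ℝ≥0∞)) (shift Γ γ x) ≤ 1) {i : ι}
    (hi : |lam i| < 1) {v : ι → ℝ} (hv : v ∈ Γ) (hvi : v i ≠ 0) (hv0 : ∀ k ≠ i, v k = 0) :
    ¬ ∀ᵐ x, ∃ j, dil lam j x ∈ W := by
  intro hcov
  set K₁ : ℝ≥0∞ := ∑' m : ℕ, ENNReal.ofReal |∏ i, lam i|⁻¹ ^ m * volume W
  set K₂ : ℝ≥0∞ := ∑' m : ℕ, ENNReal.ofReal |lam i| ^ m * ENNReal.ofReal |v i|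
  have hgeom : ∀ a : ℝ, a < 1 → ∀ b : ℝ≥0∞, b ≠ ⊤ →
      ∑' m : ℕ, ENNReal.ofReal a ^ m * b ≠ ⊤ := by
    intro a ha b hb
    rw [ENNReal.tsum_mul_right, ENNReal.tsum_geometric]
    refine ENNReal.mul_ne_top (ENNReal.inv_ne_top.2 ?_) hb
    exact (tsub_pos_of_lt (ENNReal.ofReal_lt_one.2 ha)).ne'
  have hK₁ : K₁ ≠ ⊤ := hgeom _ (inv_lt_one_of_one_lt₀ hd) _ (volume_lt_top_of_packs Γ hW hp).ne
  have hK₂ : K₂ ≠ ⊤ := hgeom _ hi _ ENNReal.ofReal_ne_top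
  set n := Fintype.card ι
  have hn : n - 1 + 1 = n := Nat.sub_add_cancel (Fintype.card_pos_iff.2 ⟨i⟩)
  -- `K₁` bounds the part of the cube reaching `W` under nonnegative powers of `A`, and `K₂ * N ^ (n
  -- - 1)` the part reaching it under nonpositive powers; this fails for large `N`.
  have hbound : ∀ N : ℕ, (N : ℝ≥0∞) ^ n ≤ K₁ + K₂ * N ^ (n - 1) := by
    intro N
    let B : Set (ι → ℝ) := Set.univ.pi fun _ => Set.Icc (-(N / 2 : ℝ)) (N / 2)
    have hN : ENNReal.ofReal (2 * (N / 2 : ℝ)) = N := by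
      rw [mul_div_cancel₀ _ two_ne_zero, ENNReal.ofReal_natCast]
    have hB : volume B = (N : ℝ≥0∞) ^ n := by
      rw [volume_pi_pi, Finset.prod_const, Real.volume_Icc, Finset.card_univ, ← hN]
      congr 2
      ring
    have hae : B ≤ᵐ[volume] ((⋃ m : ℕ, dil lam (m : ℤ) ⁻¹' W) ∪
        ⋃ m : ℕ, B ∩ dil lam (-(m : ℤ)) ⁻¹' W : Set (ι → ℝ)) := by
      filter_upwards [hcov] with x ⟨j, hj⟩ hx
      obtain ⟨m, rfl | rfl⟩ := j.eq_nat_or_neg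
      · exact Or.inl (Set.mem_iUnion.2 ⟨m, hj⟩)
      · exact Or.inr (Set.mem_iUnion.2 ⟨m, hx, hj⟩)
    rw [← hB]
    refine (measure_mono_ae hae).trans ((measure_union_le _ _).trans (add_le_add ?_ ?_))
    · refine (measure_iUnion_le _).trans (ENNReal.tsum_le_tsum fun m => ?_)
      rw [volume_preimage_dil h, zpow_neg, zpow_natCast, ← inv_pow,
        ENNReal.ofReal_pow (by positivity)]
    · rw [← ENNReal.tsum_mul_right]
      refine (measure_iUnion_le _).trans (ENNReal.tsum_le_tsum fun m => ?_)
      refine (volume_box_inter_preimage_dil_le Γ h hW hp hv hvi hv0 m _).trans_eq ?_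
      rw [hN, ENNReal.ofReal_mul (by positivity), ENNReal.ofReal_pow (abs_nonneg _)]
  obtain ⟨N, hN⟩ := ENNReal.exists_nat_gt (ENNReal.add_ne_top.2 ⟨hK₁, hK₂⟩)
  have hN1 : (1 : ℝ≥0∞) ≤ N := by
    rw [Nat.one_le_cast, Nat.one_le_iff_ne_zero]
    rintro rfl
    simp at hN
  have h1 : (N : ℝ≥0∞) * N ^ (n - 1) ≤ (K₁ + K₂) * N ^ (n - 1) := by
    rw [← pow_succ', hn, add_mul]
    refine (hbound N).trans (add_le_add_left ?_ _)
    exact le_mul_of_one_le_right' (one_le_pow₀ hN1)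
  have hne0 : (N : ℝ≥0∞) ^ (n - 1) ≠ 0 := pow_ne_zero _ (zero_lt_one.trans_le hN1).ne'
  have hnet : (N : ℝ≥0∞) ^ (n - 1) ≠ ⊤ := ENNReal.pow_ne_top (ENNReal.natCast_ne_top N)
  exact absurd ((ENNReal.mul_le_mul_iff_left hne0 hnet).1 h1) (not_le.2 hN)

end Obstruction

/-! ### The characterization. -/

theorem theorem6p5 (n : ℕ) (hn : 2 ≤ n) (lam : Fin n → ℝ)
    (hdet : 1 < |(Matrix.diagonal lam).det|)
    (hanti : ∀ i j : Fin n, i ≤ j → |lam j| ≤ |lam i|)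
    (hbig : 1 < |lam ⟨n - 2, by omega⟩|)
    (hsmall : |lam ⟨n - 1, by omega⟩| < 1)
    (hprod : 1 ≤ |lam ⟨n - 1, by omega⟩ * lam ⟨n - 2, by omega⟩|)
    (Γ : Submodule ℤ (Fin n → ℝ)) [DiscreteTopology Γ] [IsZLattice ℝ Γ] :
    (∃ W : Set (Fin n → ℝ), IsWaveletSet (Matrix.diagonal lam) Γ W) ↔
      (Γ : Set (Fin n → ℝ)) ∩
        (Submodule.span ℝ {(Pi.single ⟨n - 1, by omega⟩ 1 : Fin n → ℝ)} : Set (Fin n → ℝ)) = {0} := by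
  rw [Matrix.det_diagonal] at hdet
  have h : ∀ i, lam i ≠ 0 := by
    intro i hi
    rw [Finset.prod_eq_zero (Finset.mem_univ i) hi, abs_zero] at hdet
    linarith
  set p : Fin n := ⟨n - 2, by omega⟩ with hp
  set q : Fin n := ⟨n - 1, by omega⟩ with hq
  have hbig' : ∀ i, i ≠ q → |lam p| ≤ |lam i| := by
    intro i hi
    refine hanti i p (Fin.le_def.2 ?_)
    have : i.1 ≠ n - 1 := fun hc => hi (Fin.ext hc)
    have := i.2
    simp only [hp]
    omega
  have hfl := isFlow_dil h
  constructor
  · rintro ⟨W, hW⟩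
    refine Set.eq_singleton_iff_unique_mem.2 ⟨⟨Γ.zero_mem, Submodule.zero_mem _⟩, ?_⟩
    rintro v ⟨hvΓ, hv⟩
    obtain ⟨a, rfl⟩ := Submodule.mem_span_singleton.1 hv
    by_contra hne
    refine not_covers_of_contracting_lattice_vector Γ h hdet hW.measurable hW.packs_trans hsmall
      hvΓ ?_ ?_ ?_
    · intro ha
      apply hne
      have : a = 0 := by simpa using ha
      rw [this, zero_smul]
    · intro k hk
      simp [hk]
    · have hc := hW.covers_dil
      unfold CoversByDilations at hc
      filter_upwards [hc] with x hx
      simp only [diagonal_zpow_mulVec h] at hx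
      exact one_le_tsum_indicator_iff.1 hx
  · intro hΓ
    -- Every product of two distinct entries dominates in modulus either `lam p * lam q` or the
    -- square of `lam p`.
    have hpair : ∀ i j, i ≠ j → 1 ≤ |lam i * lam j| := by
      have key : ∀ i j, i ≠ j → i ≠ q → 1 ≤ |lam i * lam j| := by
        intro i j hij hi
        rw [abs_mul]
        by_cases hj : j = q
        · subst hj
          rw [abs_mul] at hprod
          nlinarith [hbig' i hi, abs_nonneg (lam q)]
        · nlinarith [hbig' i hi, hbig' j hj]
      intro i j hij
      by_cases hi : i = q
      · rw [mul_comm]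
        exact key j i hij.symm fun hj => hij (hi.trans hj.symm)
      · exact key i j hij hi
    -- A vector vanishing in all expanding coordinates lies on the last axis.
    have hesc : ∀ v ∈ Γ, v ≠ 0 → ∃ i, 1 < |lam i| ∧ v i ≠ 0 := by
      intro v hv hv0
      by_contra! hcon
      have hmem : v ∈ (Γ : Set (Fin n → ℝ)) ∩
          (Submodule.span ℝ {(Pi.single q 1 : Fin n → ℝ)} : Set (Fin n → ℝ)) := by
        refine ⟨hv, Submodule.mem_span_singleton.2 ⟨v q, ?_⟩⟩
        ext i
        by_cases hi : i = q
        · subst hi; simp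
        · simp [hi, hcon i (hbig.trans_le (hbig' i hi))]
      rw [hΓ] at hmem
      exact hv0 hmem
    obtain ⟨U, hU, hUT, hUS, hUc⟩ := exists_dil_packing_shift_tile Γ hbig
    obtain ⟨V, hV, hVT, hVS, hVc⟩ := exists_dil_tile_shift_packing Γ h hdet hbig
      fun R hR => exists_frequently_card_le Γ h hpair hesc hR
    obtain ⟨W, hW, hWT, hWS, hWTc, hWSc⟩ := exists_common_tile (μ := volume) hfl (isFlow_shift Γ)
      (measurable_dil lam) (fun γ => (measurePreserving_shift Γ γ).measurable) hU hV hUT hUS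
      (Filter.Eventually.of_forall hUc) hVT hVS hVc
    refine ⟨W, hW.nullMeasurableSet, ?_, ?_, ?_, ?_⟩
    · refine Filter.Eventually.of_forall fun x => ?_
      simp only [diagonal_zpow_mulVec h]
      exact hWT.tsum_indicator_le hfl x
    · filter_upwards [hWTc] with x hx
      simp only [diagonal_zpow_mulVec h]
      exact one_le_tsum_indicator_iff.2 hx
    · exact Filter.Eventually.of_forall fun x => hWS.tsum_indicator_le (isFlow_shift Γ) x
    · filter_upwards [hWSc] with x hx
      exact one_le_tsum_indicator_iff.2 hx
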